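/- Let $K$ be an algebraically closed field, complete with respect to a non-trivial non-archimedean absolute value $|\cdot|$, and let $X$ be a variety over $K$ (an integral separated scheme of finite type over $K$). Let $X^{\mathrm{an}}$ be its Berkovich analytification, as a topological space: for an open affine $U=\mathrm{Spec}(A)$ of $X$, $U^{\mathrm{an}}$ is the set of multiplicative seminorms $p$ on $A$ extending $|\cdot|$, with the topology generated by the functions $p\mapsto p(a)$ for $a\in A$, and $X^{\mathrm{an}}$ is obtained from these spaces by glueing. We write $|g(p)|$ for the value at $g\in\mathcal O(U)$ of the seminorm given by $p\in U^{\mathrm{an}}$. An open subset $U$ of $X$ is *very affine* if it has a closed embedding (over $K$) into a torus $\mathbb G_m^r$ for some $r\ge 0$. For an open subset $U$ that is very affine, put $M_U:=\mathcal O(U)^\times/K^\times$ (more precisely, modulo the image of $K^\times$), $T_U:=\mathrm{Spec}(K[M_U])$ and $(N_U)_{\mathbb R}:=\mathrm{Hom}(M_U,\mathbb R)$ with the topology of pointwise convergence. A *canonical moment map* of $U$ is a $K$-morphism $\varphi_U:U\to T_U$ such that for every $m\in M_U$ the function $\varphi_U^*(\chi^m)\in\mathcal O(U)^\times$ represents $m$;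 it is unique up to translation by an element of $T_U(K)$. It induces the tropicalization map $$\mathrm{trop}_U:U^{\mathrm{an}}\to (N_U)_{\mathbb R},\qquad p\mapsto \bigl(m\mapsto -\log|\varphi_U^*(\chi^m)(p)|\bigr),$$ and we set $\mathrm{Trop}(U):=\mathrm{trop}_U(U^{\mathrm{an}})$ with the subspace topology. A *tropical chart* $(V,\varphi_U)$ on $X^{\mathrm{an}}$ consists of a very affine open subset $U$ of $X$, a canonical moment map $\varphi_U$, and an open subset $V$ of $X^{\mathrm{an}}$ contained in $U^{\mathrm{an}}$ such that $V=\mathrm{trop}_U^{-1}(\Omega)$ for some open subset $\Omega$ of $\mathrm{Trop}(U)$. A tropical chart $(V',\varphi_{U'})$ is a *tropical subchart* of a tropical chart $(V,\varphi_U)$ if $V'\subset V$ and $U'\subset U$. **Proposition.** The tropical charts on $X^{\mathrm{an}}$ have the following properties. (a) They form a basis of the topology of $X^{\mathrm{an}}$: for every open subset $W$ of $X^{\mathrm{an}}$ and every $x\in W$, there is a tropical chart $(V,\varphi_U)$ with $x\in V\subset W$. Moreover, it can be chosen such that the open subset $\mathrm{trop}_U(V)$ of $\mathrm{Trop}(U)$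 is relatively compact, i.e. has compact closure in $\mathrm{Trop}(U)$. (b) If $(V,\varphi_U)$ and $(V',\varphi_{U'})$ are tropical charts, then $U\cap U'$ is very affine and has a canonical moment map, and for every canonical moment map $\varphi_{U\cap U'}$ of $U\cap U'$ the pair $(V\cap V',\varphi_{U\cap U'})$ is a tropical chart which is a tropical subchart of both. (c) If $(V,\varphi_U)$ is a tropical chart and $U''\subset U$ is a very affine open subset with $V\subset (U'')^{\mathrm{an}}$, then $U''$ has a canonical moment map, and for every canonical moment map $\varphi_{U''}$ of $U''$ the pair $(V,\varphi_{U''})$ is a tropical chart which is a tropical subchart of $(V,\varphi_U)$. -/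

import Mathlib

open CategoryTheory AlgebraicGeometry

universe u

noncomputable section

namespace TropicalCharts

variable {K : Type u} [NontriviallyNormedField K] {X : Scheme.{u}}

/-- The structure homomorphism `K → 𝒪(U)` for an open subset `U` of a scheme `f : X ⟶ Spec K`. -/
def scalar (f : X ⟶ Spec (CommRingCat.of K)) (U : X.Opens) : K →+* Γ(X, U) :=
  ((Scheme.ΓSpecIso (CommRingCat.of K)).inv ≫ f.appLE ⊤ U le_top).hom

/-- The analytification `X^an` of a scheme `f : X ⟶ Spec K`, as a set: its points are the pairs
consisting of a point `x` of `X` and an absolute value on the residue field `κ(x)` which extends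
the given absolute value of `K`. If `x` lies in an open affine `U = Spec A`, this is the same as a
multiplicative seminorm on `A` extending the absolute value of `K`, where `x ∈ Spec A` is the
kernel of the seminorm; see `Analytification.seminorm`. -/
structure Analytification (f : X ⟶ Spec (CommRingCat.of K)) where
  point : X
  abv : AbsoluteValue (X.residueField point) ℝ
  abv_scalar : ∀ a : K, abv (X.evaluation ⊤ point trivial (scalar f ⊤ a)) = ‖a‖

/-- `U^an` as a subset of `X^an`. -/
def anOpen (f : X ⟶ Spec (CommRingCat.of K)) (U : X.Opens) : Set (Analytification f) :=
  {p | p.point ∈ U}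

/-- The seminorm `g ↦ |g(p)|` on `𝒪(U)` given by a point `p` of `U^an`. -/
def Analytification.seminorm {f : X ⟶ Spec (CommRingCat.of K)} {U : X.Opens}
    (p : anOpen f U) (g : Γ(X, U)) : ℝ :=
  p.1.abv (X.evaluation U p.1.point p.2 g)

/-- For `U` affine: the topology on `U^an` generated by the functions `p ↦ |g(p)|`, `g ∈ 𝒪(U)`. -/
abbrev affineTopology (f : X ⟶ Spec (CommRingCat.of K)) (U : X.Opens) :
    TopologicalSpace (anOpen f U) :=
  TopologicalSpace.induced (fun p (g : Γ(X, U)) => Analytification.seminorm p g)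
    Pi.topologicalSpace

/-- The topology of `X^an` is glued from the topologies of the `U^an` with `U` open affine:
`W` is open if and only if `W ∩ U^an` is open in `U^an` for every open affine `U`. -/
instance (f : X ⟶ Spec (CommRingCat.of K)) : TopologicalSpace (Analytification f) :=
  ⨆ U : X.affineOpens, TopologicalSpace.coinduced Subtype.val (affineTopology f U.1)

/-- The split torus `Spec K[M]` with character group `M` (written multiplicatively). -/
abbrev torus (K : Type u) [Field K] (M : Type u) [CommGroup M] : Scheme.{u} :=
  Spec (CommRingCat.of (MonoidAlgebra K M))

/-- The structure morphism of `Spec K[M]`. -/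
def torusStructure (K : Type u) [Field K] (M : Type u) [CommGroup M] :
    torus K M ⟶ Spec (CommRingCat.of K) :=
  Spec.map (CommRingCat.ofHom (algebraMap K (MonoidAlgebra K M)))

/-- A moment map on the open subset `U` of `X`: a morphism over `K` from `U` to `Spec K[M]`. -/
structure MomentMap (f : X ⟶ Spec (CommRingCat.of K)) (U : X.Opens) (M : Type u)
    [CommGroup M] where
  hom : U.toScheme ⟶ torus K M
  hom_over : hom ≫ torusStructure K M = U.ι ≫ f

/-- `U` is very affine if it has a closed embedding into a multiplicative torus `𝔾_m^r`. -/
def IsVeryAffine (f : X ⟶ Spec (CommRingCat.of K)) (U : X.Opens) : Prop :=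
  ∃ (r : ℕ) (φ : MomentMap f U (ULift.{u} (Multiplicative (Fin r → ℤ)))),
    IsClosedImmersion φ.hom

namespace MomentMap

variable {f : X ⟶ Spec (CommRingCat.of K)} {U : X.Opens} {M : Type u} [CommGroup M]

/-- The pull-back `K[M] → 𝒪(U)` of functions along a moment map. -/
def pullback (φ : MomentMap f U M) : MonoidAlgebra K M →+* Γ(X, U) :=
  ((Scheme.ΓSpecIso (CommRingCat.of (MonoidAlgebra K M))).inv ≫
    φ.hom.appTop ≫ U.topIso.hom).hom

/-- The unit `φ^*(χ^m)` of `𝒪(U)` obtained by pulling back the character `χ^m`. -/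
def character (φ : MomentMap f U M) : M →* Γ(X, U)ˣ :=
  ((φ.pullback : MonoidAlgebra K M →* Γ(X, U)).comp (MonoidAlgebra.of K M)).toHomUnits

end MomentMap

/-- For a character group `M` with dual `N`, the real vector space `N_ℝ = Hom(M, ℝ)`. -/
def CocharacterSpace (M : Type u) [CommGroup M] : Type u := Additive M →+ ℝ

/-- The topology of `N_ℝ = Hom(M, ℝ)`: pointwise convergence on `M`
(for `M ≅ ℤ^r` this is the usual topology of `ℝ^r`). -/
instance (M : Type u) [CommGroup M] : TopologicalSpace (CocharacterSpace M) :=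
  TopologicalSpace.induced (fun (n : Additive M →+ ℝ) (m : Additive M) => n m)
    Pi.topologicalSpace

theorem seminorm_unit_ne_zero {f : X ⟶ Spec (CommRingCat.of K)} {U : X.Opens}
    (p : anOpen f U) (g : Γ(X, U)ˣ) : Analytification.seminorm p (g : Γ(X, U)) ≠ 0 := by
  have h : IsUnit (X.evaluation U p.1.point p.2 (g : Γ(X, U))) :=
    g.isUnit.map (X.evaluation U p.1.point p.2).hom
  exact p.1.abv.ne_zero h.ne_zero

theorem seminorm_mul {f : X ⟶ Spec (CommRingCat.of K)} {U : X.Opens}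
    (p : anOpen f U) (g h : Γ(X, U)) :
    Analytification.seminorm p (g * h) =
      Analytification.seminorm p g * Analytification.seminorm p h := by
  simp [Analytification.seminorm]

/-- The tropicalization `φ_trop : U^an → N_ℝ` of a moment map `φ`, i.e. the composite of `φ^an`
(composition of seminorms with `φ^*`) with `trop : T^an → N_ℝ`, `q ↦ (m ↦ -log |χ^m(q)|)`. -/
def MomentMap.trop {f : X ⟶ Spec (CommRingCat.of K)} {U : X.Opens} {M : Type u} [CommGroup M]
    (φ : MomentMap f U M) (p : anOpen f U) : CocharacterSpace M :=
  (AddMonoidHom.mk' (fun m : Additive M =>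
    -Real.log (Analytification.seminorm p (φ.character m.toMul : Γ(X, U)))) (by
      intro a b
      simp only [toMul_add, map_mul, Units.val_mul, seminorm_mul]
      rw [Real.log_mul (seminorm_unit_ne_zero p _) (seminorm_unit_ne_zero p _)]
      ring) : Additive M →+ ℝ)

/-- The group `M_U = 𝒪(U)ˣ / Kˣ`. -/
abbrev unitLattice (f : X ⟶ Spec (CommRingCat.of K)) (U : X.Opens) : Type u :=
  Γ(X, U)ˣ ⧸ (Units.map (scalar f U : K →* Γ(X, U))).range

/-- A canonical moment map `φ_U : U → T_U = Spec K[M_U]`: the characters `m ∈ M_U` are pulled back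
to representatives of `m` in `𝒪(U)ˣ` (chosen multiplicatively, equivalently on a basis of `M_U`).
It is determined up to translation by an element of `T_U(K) = Hom(M_U, Kˣ)`. -/
structure CanonicalMomentMap (f : X ⟶ Spec (CommRingCat.of K)) (U : X.Opens) extends
    MomentMap f U (unitLattice f U) where
  character_eq : ∀ m : unitLattice f U, (toMomentMap.character m : unitLattice f U) = m

namespace CanonicalMomentMap

variable {f : X ⟶ Spec (CommRingCat.of K)} {U : X.Opens}

/-- `Trop(U) = trop_U(U^an)`, a subset of `(N_U)_ℝ`. -/
def Trop (φ : CanonicalMomentMap f U) : Set (CocharacterSpace (unitLattice f U)) :=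
  Set.range φ.trop

/-- The tropicalization map `trop_U`, as a map from `U^an` onto `Trop(U)`. -/
def tropU (φ : CanonicalMomentMap f U) : anOpen f U → φ.Trop :=
  Set.rangeFactorization φ.trop

/-- `trop_U(V)` as a subset of `Trop(U)`, for `V ⊆ U^an ⊆ X^an`. -/
def tropImage (φ : CanonicalMomentMap f U) (V : Set (Analytification f)) : Set φ.Trop :=
  φ.tropU '' (Subtype.val ⁻¹' V)

end CanonicalMomentMap

/-- `(V, φ_U)` is a tropical chart on `X^an`: `U` is very affine, `V ⊆ U^an` is open in `X^an` and
`V = trop_U⁻¹(Ω)` for some open subset `Ω` of `Trop(U)`. -/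
structure IsTropicalChart {f : X ⟶ Spec (CommRingCat.of K)} {U : X.Opens}
    (V : Set (Analytification f)) (φ : CanonicalMomentMap f U) : Prop where
  isVeryAffine : IsVeryAffine f U
  isOpen : IsOpen V
  subset : V ⊆ anOpen f U
  exists_preimage : ∃ Ω : Set φ.Trop, IsOpen Ω ∧ V = Subtype.val '' (φ.tropU ⁻¹' Ω)

/-- The tropical chart `(V', φ_{U'})` is a tropical subchart of the tropical chart `(V, φ_U)`. -/
structure IsTropicalSubchart {f : X ⟶ Spec (CommRingCat.of K)} {U' U : X.Opens}
    (V' : Set (Analytification f)) (φ' : CanonicalMomentMap f U')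
    (V : Set (Analytification f)) (φ : CanonicalMomentMap f U) : Prop where
  chart' : IsTropicalChart V' φ'
  chart : IsTropicalChart V φ
  subset : V' ⊆ V
  le : U' ≤ U

end TropicalCharts

end

/-! The proof rests on an algebraic description of charts: `U` is very affine exactly when it is
affine and `𝒪(U)` is generated by `K` and a finitely generated group of units (`isVeryAffine_iff`).
Canonical moment maps exist because `Kˣ` is divisible, so that `𝒪(U)ˣ → M_U` splits.

Basis property. Near `x`, an open set contains a box given by finitely many conditions on `|g|`,
with `g` a function on an affine `U`. Adding small constants to these `g`, and to generators of
`𝒪(U)`, makes them nonzero at `x` and barely changes their absolute values. Where all of them are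
invertible, one obtains a very affine `D` together with units approximating the `g`
(`exists_units_approximating`). On `D^an` the absolute value of a unit is a continuous function of
`trop_D` (`exists_seminorm_unit_eq`), so a box in finitely many units is a tropical chart. If the
box keeps generating units away from `0`, every function is bounded on its closed version, which is
compact by Tychonoff (`isCompact_of_forall_bounded`); its continuous image under `trop_D` is compact
too.

Intersections and subcharts. By separatedness `𝒪(U ∩ U')` is generated by restrictions from `U` and
`U'`, hence by units. For `V ≤ U` a unit on `U` restricts to a unit on `V`, so `trop_U` factors
continuously through `trop_V` (`exists_continuous_factor`), and open sets of tropicalizations pull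
back. -/

noncomputable section

namespace TropicalCharts

/-! ### Restriction of functions and rules for seminorms -/

section Sections

variable {K : Type u} [NontriviallyNormedField K] {X : Scheme.{u}}

/-- The restriction map `𝒪(U) → 𝒪(V)` for `V ≤ U`. -/
def res {U V : X.Opens} (h : V ≤ U) : Γ(X, U) →+* Γ(X, V) :=
  (X.presheaf.map (homOfLE h).op).hom

theorem res_scalar (f : X ⟶ Spec (CommRingCat.of K)) {U V : X.Opens} (h : V ≤ U) (a : K) :
    res h (scalar f U a) = scalar f V a := by
  have h1 : f.appLE ⊤ U le_top ≫ X.presheaf.map (homOfLE h).op = f.appLE ⊤ V le_top :=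
    Scheme.Hom.appLE_map _ _ _
  exact congrArg (fun t => ((Scheme.ΓSpecIso (CommRingCat.of K)).inv ≫ t).hom a) h1

theorem evaluation_res {U V : X.Opens} (h : V ≤ U) (x : X) (hx : x ∈ V) (g : Γ(X, U)) :
    X.evaluation V x hx (res h g) = X.evaluation U x (h hx) g := by
  simp only [Scheme.evaluation, CommRingCat.comp_apply, res]
  congr 1
  exact X.presheaf.germ_res_apply (homOfLE h) x hx g

theorem seminorm_res {f : X ⟶ Spec (CommRingCat.of K)} {U V : X.Opens} (h : V ≤ U)
    (p : anOpen f V) (g : Γ(X, U)) :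
    Analytification.seminorm p (res h g) =
      Analytification.seminorm (U := U) ⟨p.1, h p.2⟩ g :=
  congrArg p.1.abv (evaluation_res h _ p.2 g)

theorem seminorm_scalar {f : X ⟶ Spec (CommRingCat.of K)} {U : X.Opens}
    (p : anOpen f U) (a : K) : Analytification.seminorm p (scalar f U a) = ‖a‖ := by
  rw [← res_scalar f le_top, seminorm_res]
  exact p.1.abv_scalar a

theorem seminorm_nonneg {f : X ⟶ Spec (CommRingCat.of K)} {U : X.Opens}
    (p : anOpen f U) (g : Γ(X, U)) : 0 ≤ Analytification.seminorm p g :=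
  p.1.abv.nonneg _

theorem seminorm_add_le {f : X ⟶ Spec (CommRingCat.of K)} {U : X.Opens}
    (p : anOpen f U) (g h : Γ(X, U)) : Analytification.seminorm p (g + h) ≤
      Analytification.seminorm p g + Analytification.seminorm p h := by
  simpa [Analytification.seminorm] using p.1.abv.add_le _ _

theorem seminorm_neg {f : X ⟶ Spec (CommRingCat.of K)} {U : X.Opens}
    (p : anOpen f U) (g : Γ(X, U)) :
    Analytification.seminorm p (-g) = Analytification.seminorm p g := by
  simp [Analytification.seminorm]

theorem seminorm_one {f : X ⟶ Spec (CommRingCat.of K)} {U : X.Opens}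
    (p : anOpen f U) : Analytification.seminorm p (1 : Γ(X, U)) = 1 := by
  simp [Analytification.seminorm]

theorem seminorm_zero {f : X ⟶ Spec (CommRingCat.of K)} {U : X.Opens}
    (p : anOpen f U) : Analytification.seminorm p (0 : Γ(X, U)) = 0 := by
  simp [Analytification.seminorm]

theorem seminorm_eq_zero_iff {f : X ⟶ Spec (CommRingCat.of K)} {U : X.Opens}
    (p : anOpen f U) (g : Γ(X, U)) :
    Analytification.seminorm p g = 0 ↔ p.1.point ∉ X.basicOpen g := by
  rw [Analytification.seminorm, map_eq_zero]
  exact X.evaluation_eq_zero_iff_notMem_basicOpen _ _ _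

theorem seminorm_pow {f : X ⟶ Spec (CommRingCat.of K)} {U : X.Opens}
    (p : anOpen f U) (g : Γ(X, U)) (n : ℕ) :
    Analytification.seminorm p (g ^ n) = Analytification.seminorm p g ^ n := by
  simp [Analytification.seminorm]

end Sections

/-! ### Moment maps as algebra homomorphisms; very affine open subsets -/

section MomentMaps

variable {K : Type u} [NontriviallyNormedField K] {X : Scheme.{u}}
  {f : X ⟶ Spec (CommRingCat.of K)} {U : X.Opens} {M : Type u} [CommGroup M]

theorem toSpecΓ_map_scalar (f : X ⟶ Spec (CommRingCat.of K)) (U : X.Opens) :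
    U.toSpecΓ ≫ Spec.map (CommRingCat.ofHom (scalar f U)) = U.ι ≫ f := by
  apply ext_of_isAffine
  have h : f.appLE ⊤ U le_top = f.appTop ≫ X.presheaf.map (homOfLE le_top).op := rfl
  simp only [scalar, CommRingCat.ofHom_hom]
  rw [Scheme.Hom.comp_appTop, Scheme.Hom.comp_appTop, Scheme.Opens.toSpecΓ_appTop,
    Scheme.ΓSpecIso_naturality_assoc, Category.assoc, Iso.hom_inv_id_assoc, h, Category.assoc]
  congr 1
  rw [Scheme.Opens.topIso_inv]
  exact (X.presheaf.map_comp _ _).symm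

theorem MomentMap.pullback_algebraMap (φ : MomentMap f U M) (a : K) :
    φ.pullback (algebraMap K (MonoidAlgebra K M) a) = scalar f U a := by
  have h := congrArg Scheme.Hom.appTop φ.hom_over
  have h2 := congrArg Scheme.Hom.appTop (toSpecΓ_map_scalar f U)
  rw [← h, Scheme.Hom.comp_appTop, Scheme.Hom.comp_appTop, Scheme.Opens.toSpecΓ_appTop,
    torusStructure, Scheme.ΓSpecIso_naturality_assoc] at h2
  have h3 := congrArg (fun t => (Scheme.ΓSpecIso (CommRingCat.of K)).inv ≫ t ≫ U.topIso.hom) h2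
  simp only [Category.assoc, Iso.inv_hom_id, Iso.inv_hom_id_assoc, Category.comp_id,
    ← Scheme.ΓSpecIso_inv_naturality_assoc] at h3
  have h4 := congrArg (fun t => t.hom a) h3
  exact h4.symm

/-- The morphism `U → Spec K[M]` corresponding to a `K`-algebra homomorphism `K[M] → 𝒪(U)`. -/
def MomentMap.ofRingHom (θ : MonoidAlgebra K M →+* Γ(X, U))
    (hθ : θ.comp (algebraMap K (MonoidAlgebra K M)) = scalar f U) : MomentMap f U M where
  hom := U.toSpecΓ ≫ Spec.map (CommRingCat.ofHom θ)
  hom_over := by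
    rw [torusStructure, Category.assoc, ← Spec.map_comp, ← CommRingCat.ofHom_comp, hθ,
      toSpecΓ_map_scalar]

theorem MomentMap.pullback_ofRingHom (θ : MonoidAlgebra K M →+* Γ(X, U))
    (hθ : θ.comp (algebraMap K (MonoidAlgebra K M)) = scalar f U) :
    (MomentMap.ofRingHom θ hθ).pullback = θ := by
  simp only [MomentMap.pullback, MomentMap.ofRingHom, Scheme.Hom.comp_appTop,
    Scheme.Opens.toSpecΓ_appTop, Category.assoc, Iso.inv_hom_id, Category.comp_id]
  have h := Scheme.ΓSpecIso_naturality (S := Γ(X, U)) (CommRingCat.ofHom θ)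
  rw [h, Iso.inv_hom_id_assoc, CommRingCat.hom_ofHom]

theorem MomentMap.coe_character (φ : MomentMap f U M) (m : M) :
    (φ.character m : Γ(X, U)) = φ.pullback (MonoidAlgebra.of K M m) := rfl

/-- The homomorphism `K[M] → 𝒪(U)` corresponding to a homomorphism `M → 𝒪(U)ˣ`. -/
def unitsLift (f : X ⟶ Spec (CommRingCat.of K)) (U : X.Opens) (χ : M →* Γ(X, U)ˣ) :
    MonoidAlgebra K M →+* Γ(X, U) :=
  MonoidAlgebra.liftNCRingHom (scalar f U) ((Units.coeHom _).comp χ) (fun _ _ => mul_comm _ _)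

theorem unitsLift_of (χ : M →* Γ(X, U)ˣ) (m : M) :
    unitsLift f U χ (MonoidAlgebra.of K M m) = χ m := by
  simp [unitsLift, MonoidAlgebra.liftNCRingHom]

theorem unitsLift_algebraMap (χ : M →* Γ(X, U)ˣ) (a : K) :
    unitsLift f U χ (algebraMap K (MonoidAlgebra K M) a) = scalar f U a := by
  simp [unitsLift, MonoidAlgebra.liftNCRingHom]

/-- The moment map with prescribed characters. -/
def MomentMap.ofUnits (f : X ⟶ Spec (CommRingCat.of K)) (U : X.Opens) (χ : M →* Γ(X, U)ˣ) :
    MomentMap f U M :=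
  MomentMap.ofRingHom (unitsLift f U χ) (RingHom.ext (unitsLift_algebraMap χ))

theorem MomentMap.character_ofUnits (χ : M →* Γ(X, U)ˣ) :
    (MomentMap.ofUnits f U χ).character = χ := by
  ext m
  rw [coe_character, ofUnits, pullback_ofRingHom, unitsLift_of]

/-- The subring of `𝒪(U)` generated by `K` and the units in `H`. -/
def unitSubring (f : X ⟶ Spec (CommRingCat.of K)) (U : X.Opens) (H : Subgroup Γ(X, U)ˣ) :
    Subring Γ(X, U) :=
  Subring.closure (Set.range (scalar f U) ∪ Units.val '' (H : Set Γ(X, U)ˣ))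

/-- `K[M]` is spanned over `K` by the characters, so its image depends only on the group of units
that they hit. -/
theorem MomentMap.range_pullback (φ : MomentMap f U M) :
    φ.pullback.range = unitSubring f U φ.character.range := by
  apply le_antisymm
  · rintro _ ⟨y, rfl⟩
    induction y using MonoidAlgebra.induction_on with
    | of m => exact Subring.subset_closure (Or.inr ⟨φ.character m, ⟨m, rfl⟩, rfl⟩)
    | add a b ha hb => rw [map_add]; exact add_mem ha hb
    | smul r a ha =>
      rw [Algebra.smul_def, map_mul]
      refine mul_mem ?_ ha
      rw [pullback_algebraMap]
      exact Subring.subset_closure (Or.inl ⟨r, rfl⟩)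
  · refine Subring.closure_le.2 ?_
    rintro _ (⟨a, rfl⟩ | ⟨_, ⟨m, rfl⟩, rfl⟩)
    · exact ⟨_, φ.pullback_algebraMap a⟩
    · exact ⟨_, rfl⟩

theorem MomentMap.isClosedImmersion_iff (φ : MomentMap f U M) :
    IsClosedImmersion φ.hom ↔ IsAffineOpen U ∧ Function.Surjective φ.pullback := by
  have key : Function.Surjective φ.pullback ↔ Function.Surjective φ.hom.appTop := by
    have h1 : Function.Bijective (Scheme.ΓSpecIso (CommRingCat.of (MonoidAlgebra K M))).inv :=
      (ConcreteCategory.bijective_of_isIso _)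
    have h2 : Function.Bijective U.topIso.hom := ConcreteCategory.bijective_of_isIso _
    have : (φ.pullback : _ → _) = U.topIso.hom ∘ φ.hom.appTop ∘
      (Scheme.ΓSpecIso (CommRingCat.of (MonoidAlgebra K M))).inv := by
      ext x; rfl
    rw [this]
    constructor
    · intro h
      have h3 := (Function.Surjective.of_comp_iff' h2 _).1 h
      exact h3.of_comp
    · intro h
      exact h2.surjective.comp (h.comp h1.surjective)
  rw [key]
  constructor
  · intro h
    exact IsClosedImmersion.isAffine_surjective_of_isAffine φ.hom
  · rintro ⟨h1, h2⟩
    have : IsAffine U := h1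
    exact IsClosedImmersion.of_surjective_of_isAffine _ h2

/-- Supplies the torus in the converse direction of `isVeryAffine_iff`: generators of the group of
units serve as coordinates. -/
theorem exists_surjective_of_fg {G : Type u} [CommGroup G] (hG : Group.FG G) :
    ∃ (r : ℕ) (χ : ULift.{u} (Multiplicative (Fin r → ℤ)) →* G), Function.Surjective χ := by
  have : Module.Finite ℤ (Additive G) := by
    rw [Module.Finite.iff_addGroup_fg]
    exact GroupFG.iff_add_fg.1 hG
  obtain ⟨r, g, hg⟩ := Module.Finite.exists_fin' ℤ (Additive G)
  refine ⟨r, (AddMonoidHom.toMultiplicativeLeft g.toAddMonoidHom).comp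
    MulEquiv.ulift.toMonoidHom, ?_⟩
  intro y
  obtain ⟨x, hx⟩ := hg (Additive.ofMul y)
  exact ⟨ULift.up (Multiplicative.ofAdd x), hx⟩

/-- An open subset is very affine if and only if it is affine and its ring of functions is
generated by finitely many units and their inverses. -/
theorem isVeryAffine_iff : IsVeryAffine f U ↔
    IsAffineOpen U ∧ ∃ H : Subgroup Γ(X, U)ˣ, H.FG ∧ unitSubring f U H = ⊤ := by
  constructor
  · rintro ⟨r, φ, hφ⟩
    rw [MomentMap.isClosedImmersion_iff] at hφ
    refine ⟨hφ.1, φ.character.range, ?_, ?_⟩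
    · have h1 : AddGroup.FG (Fin r → ℤ) := Module.Finite.iff_addGroup_fg.1 inferInstance
      have h2 : Group.FG (Multiplicative (Fin r → ℤ)) := inferInstance
      have h3 : Group.FG (ULift.{u} (Multiplicative (Fin r → ℤ))) :=
        Group.fg_of_surjective
          (f := (MulEquiv.ulift (α := Multiplicative (Fin r → ℤ))).symm.toMonoidHom)
          (MulEquiv.ulift (α := Multiplicative (Fin r → ℤ))).symm.surjective
      exact (Group.fg_iff_subgroup_fg _).1 inferInstance
    · rw [← MomentMap.range_pullback, RingHom.range_eq_top]
      exact hφ.2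
  · rintro ⟨hU, H, hH, hgen⟩
    obtain ⟨r, χ, hχ⟩ := exists_surjective_of_fg ((Group.fg_iff_subgroup_fg _).2 hH)
    refine ⟨r, MomentMap.ofUnits f U (H.subtype.comp χ), ?_⟩
    rw [MomentMap.isClosedImmersion_iff]
    refine ⟨hU, ?_⟩
    rw [← RingHom.range_eq_top, MomentMap.range_pullback, MomentMap.character_ofUnits,
      MonoidHom.range_comp, MonoidHom.range_eq_top.2 hχ, ← MonoidHom.range_eq_map,
      Subgroup.range_subtype, hgen]

end MomentMaps

/-! ### Existence of canonical moment maps -/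

section Canonical

/-- A surjection of commutative groups with divisible kernel splits. -/
theorem exists_section_of_divisible_kernel {G D : Type*} [CommGroup G] [CommGroup D] (i : D →* G)
    (hD : ∀ n : ℕ, n ≠ 0 → ∀ d : D, ∃ e, e ^ n = d) :
    ∃ s : G ⧸ i.range →* G, ∀ m, (s m : G ⧸ i.range) = m := by
  let R := i.range
  have hR : ∀ {n : ℕ}, n ≠ 0 → Function.Surjective (fun a => n • a : Additive R → Additive R) := by
    intro n hn x
    obtain ⟨d, hd⟩ := (Additive.toMul x).2
    obtain ⟨e, he⟩ := hD n hn d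
    refine ⟨Additive.ofMul ⟨i e, e, rfl⟩, ?_⟩
    apply Additive.toMul.injective
    apply Subtype.ext
    simp [← hd, ← he]
  let _ : DivisibleBy (Additive R) ℕ := divisibleByOfSMulRightSurj _ _ hR
  let _ : DivisibleBy (Additive R) ℤ := AddGroup.divisibleByIntOfDivisibleByNat _
  -- Divisible abelian groups are injective `ℤ`-modules, so the identity of `R` extends to a
  -- retraction of `G` onto `R`.
  have hB : Module.Baer ℤ (Additive R) := Module.Baer.of_divisible _
  obtain ⟨ρ, hρ⟩ := hB.extension_property
    (MonoidHom.toAdditive R.subtype).toIntLinearMap Subtype.val_injective LinearMap.id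
  have hρ' : ∀ x : R, ρ (Additive.ofMul (x : G)) = Additive.ofMul x := fun x =>
    LinearMap.congr_fun hρ (Additive.ofMul x)
  let ρ' : G →* R := MonoidHom.toAdditive.symm ρ.toAddMonoidHom
  have hρ1 : ∀ x : R, ρ' x = x := hρ'
  -- The section is `g ↦ g / ρ(g)`: it is trivial on `R`, and dividing by an element of `R` does not
  -- change the class of `g`.
  refine ⟨QuotientGroup.lift R (MonoidHom.id G / R.subtype.comp ρ') fun x hx => ?_, fun m => ?_⟩
  · have := congrArg (Subtype.val) (hρ1 ⟨x, hx⟩)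
    simp [this]
  · induction m using QuotientGroup.induction_on with
    | H g =>
      simp only [QuotientGroup.lift_mk, MonoidHom.div_apply, MonoidHom.id_apply]
      exact QuotientGroup.eq.2 (by simp)

variable {K : Type u} [NontriviallyNormedField K] {X : Scheme.{u}}

theorem nonempty_canonicalMomentMap [IsAlgClosed K] (f : X ⟶ Spec (CommRingCat.of K))
    (U : X.Opens) : Nonempty (CanonicalMomentMap f U) := by
  obtain ⟨s, hs⟩ := exists_section_of_divisible_kernel
    (Units.map (scalar f U : K →* Γ(X, U))) (by
      intro n hn d
      obtain ⟨z, hz⟩ := IsAlgClosed.exists_pow_nat_eq (d : K) (Nat.pos_of_ne_zero hn)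
      have hz0 : z ≠ 0 := by
        rintro rfl
        rw [zero_pow hn] at hz
        exact d.ne_zero hz.symm
      exact ⟨Units.mk0 z hz0, Units.ext (by simpa using hz)⟩)
  refine ⟨⟨MomentMap.ofUnits f U s, fun m => ?_⟩⟩
  rw [MomentMap.character_ofUnits]
  exact hs m

end Canonical

/-! ### Intersections of very affine open subsets -/

section Intersection

/-- Both maps land in the subring `S` generated by their images. The induced map from the pushout to
`S`, followed by the inclusion, is the identity by uniqueness, so `S` is everything. -/
theorem subring_closure_eq_top_of_isPushout {R A B P : CommRingCat.{u}} {f : R ⟶ A} {g : R ⟶ B}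
    {inl : A ⟶ P} {inr : B ⟶ P} (h : IsPushout f g inl inr) :
    inl.hom.range ⊔ inr.hom.range = ⊤ := by
  let S := inl.hom.range ⊔ inr.hom.range
  let a : A ⟶ CommRingCat.of S := CommRingCat.ofHom
    (inl.hom.codRestrict S (fun x => (le_sup_left : _ ≤ S) ⟨x, rfl⟩))
  let b : B ⟶ CommRingCat.of S := CommRingCat.ofHom
    (inr.hom.codRestrict S (fun x => (le_sup_right : _ ≤ S) ⟨x, rfl⟩))
  let ι : CommRingCat.of S ⟶ P := CommRingCat.ofHom S.subtype
  have ha : a ≫ ι = inl := rfl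
  have hb : b ≫ ι = inr := rfl
  have : Mono ι := by
    apply ConcreteCategory.mono_of_injective
    exact Subtype.val_injective
  have hab : f ≫ a = g ≫ b := by
    rw [← cancel_mono ι, Category.assoc, Category.assoc, ha, hb, h.w]
  have key : h.desc a b hab ≫ ι = 𝟙 P := by
    apply h.hom_ext <;> simp [ha, hb]
  refine eq_top_iff.2 fun x _ => ?_
  have := congrArg (fun t => t.hom x) key
  simp only [CommRingCat.hom_id, RingHom.id_apply] at this
  rw [← this]
  exact (h.desc a b hab x : S).2

variable {K : Type u} [NontriviallyNormedField K] {X : Scheme.{u}}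

/-- As `X` is separated, `U ∩ V → U ×_K V` is a closed immersion of affine schemes, so every
function on `U ∩ V` comes from `𝒪(U) ⊗_K 𝒪(V)`, which is generated by its two factors. -/
theorem range_res_sup_range_res (f : X ⟶ Spec (CommRingCat.of K)) [IsSeparated f]
    {U V : X.Opens} (hU : IsAffineOpen U) (hV : IsAffineOpen V) :
    (res (inf_le_left : U ⊓ V ≤ U)).range ⊔ (res (inf_le_right : U ⊓ V ≤ V)).range = ⊤ := by
  have : IsAffine U := hU
  have : IsAffine V := hV
  let j := (isPullback_opens_inf U V).isoPullback.hom ≫ Limits.pullback.mapDesc U.ι V.ι f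
  have hj : IsClosedImmersion j := inferInstance
  have hsurj : Function.Surjective j.appTop :=
    (IsClosedImmersion.isAffine_surjective_of_isAffine j).2
  have hP := subring_closure_eq_top_of_isPushout
    (isPushout_appTop_of_isPullback (IsPullback.of_hasPullback (U.ι ≫ f) (V.ι ≫ f)))
  have hj1 : j ≫ Limits.pullback.fst (U.ι ≫ f) (V.ι ≫ f) = X.homOfLE inf_le_left := by
    rw [Category.assoc, Limits.pullback.lift_fst, Category.comp_id]
    exact (isPullback_opens_inf U V).isoPullback_hom_fst
  have hj2 : j ≫ Limits.pullback.snd (U.ι ≫ f) (V.ι ≫ f) = X.homOfLE inf_le_right := by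
    rw [Category.assoc, Limits.pullback.lift_snd, Category.comp_id]
    exact (isPullback_opens_inf U V).isoPullback_hom_snd
  have hres : ∀ {W : X.Opens} (h : U ⊓ V ≤ W),
      (X.homOfLE h).appTop ≫ (U ⊓ V).topIso.hom = W.topIso.hom ≫ CommRingCat.ofHom (res h) := by
    intro W h
    simp only [res, Scheme.homOfLE_appTop, CommRingCat.ofHom_hom, Scheme.Opens.topIso_hom]
    exact (X.presheaf.map_comp _ _).symm.trans
      ((congrArg X.presheaf.map (Subsingleton.elim _ _)).trans (X.presheaf.map_comp _ _))
  let t : Γ(Limits.pullback (U.ι ≫ f) (V.ι ≫ f), ⊤) →+* Γ(X, U ⊓ V) :=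
    (j.appTop ≫ (U ⊓ V).topIso.hom).hom
  have ht : Function.Surjective t :=
    (ConcreteCategory.bijective_of_isIso (U ⊓ V).topIso.hom).surjective.comp hsurj
  rw [eq_top_iff, ← RingHom.range_eq_top.2 ht, RingHom.range_eq_map, ← hP, Subring.map_sup]
  refine sup_le_sup ?_ ?_
  · rintro _ ⟨_, ⟨y, rfl⟩, rfl⟩
    refine ⟨U.topIso.hom y, ?_⟩
    have h1 := congrArg (fun s => s.hom y) (hres (inf_le_left : U ⊓ V ≤ U))
    rw [← hj1, Scheme.Hom.comp_appTop] at h1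
    exact h1.symm
  · rintro _ ⟨_, ⟨y, rfl⟩, rfl⟩
    refine ⟨V.topIso.hom y, ?_⟩
    have h1 := congrArg (fun s => s.hom y) (hres (inf_le_right : U ⊓ V ≤ V))
    rw [← hj2, Scheme.Hom.comp_appTop] at h1
    exact h1.symm

theorem isAffineOpen_inf (f : X ⟶ Spec (CommRingCat.of K)) [IsSeparated f]
    {U V : X.Opens} (hU : IsAffineOpen U) (hV : IsAffineOpen V) : IsAffineOpen (U ⊓ V) := by
  have : X.IsSeparated := ⟨by
    rw [← Limits.terminal.comp_from f]; infer_instance⟩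
  exact hU.inf hV

theorem subgroup_fg_map {G H : Type*} [Group G] [Group H] {S : Subgroup G} (hS : S.FG)
    (φ : G →* H) : (S.map φ).FG := by
  obtain ⟨s, rfl, hs⟩ := (Subgroup.fg_iff S).1 hS
  exact (Subgroup.fg_iff _).2 ⟨φ '' s, (MonoidHom.map_closure φ s).symm, hs.image _⟩

theorem subgroup_fg_sup {G : Type*} [Group G] {S T : Subgroup G} (hS : S.FG) (hT : T.FG) :
    (S ⊔ T).FG := by
  obtain ⟨s, rfl, hs⟩ := (Subgroup.fg_iff S).1 hS
  obtain ⟨t, rfl, ht⟩ := (Subgroup.fg_iff T).1 hT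
  exact (Subgroup.fg_iff _).2 ⟨s ∪ t, Subgroup.closure_union s t, hs.union ht⟩

/-- The restriction map on units. -/
def resUnits {U V : X.Opens} (h : V ≤ U) : Γ(X, U)ˣ →* Γ(X, V)ˣ :=
  Units.map (res h : Γ(X, U) →* Γ(X, V))

theorem coe_resUnits {U V : X.Opens} (h : V ≤ U) (g : Γ(X, U)ˣ) :
    (resUnits h g : Γ(X, V)) = res h g := rfl

theorem range_res_le_unitSubring (f : X ⟶ Spec (CommRingCat.of K)) {U V : X.Opens} (h : V ≤ U)
    {H : Subgroup Γ(X, U)ˣ} (hH : unitSubring f U H = ⊤) {H' : Subgroup Γ(X, V)ˣ}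
    (hle : H.map (resUnits h) ≤ H') : (res h).range ≤ unitSubring f V H' := by
  rw [RingHom.range_eq_map, ← hH, unitSubring, RingHom.map_closure, Subring.closure_le]
  rintro _ ⟨_, (⟨a, rfl⟩ | ⟨v, hv, rfl⟩), rfl⟩
  · exact Subring.subset_closure (Or.inl ⟨a, (res_scalar f h a).symm⟩)
  · exact Subring.subset_closure (Or.inr ⟨resUnits h v, hle ⟨v, hv, rfl⟩, rfl⟩)

/-- In a separated scheme the intersection of two very affine open subsets is very affine. -/
theorem isVeryAffine_inf {f : X ⟶ Spec (CommRingCat.of K)} [IsSeparated f]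
    {U V : X.Opens} (hU : IsVeryAffine f U) (hV : IsVeryAffine f V) : IsVeryAffine f (U ⊓ V) := by
  rw [isVeryAffine_iff] at hU hV ⊢
  obtain ⟨aU, H, hH, hHgen⟩ := hU
  obtain ⟨aV, H', hH', hHgen'⟩ := hV
  refine ⟨isAffineOpen_inf f aU aV, H.map (resUnits inf_le_left) ⊔ H'.map (resUnits inf_le_right),
    subgroup_fg_sup (subgroup_fg_map hH _) (subgroup_fg_map hH' _), ?_⟩
  rw [eq_top_iff, ← range_res_sup_range_res f aU aV]
  exact sup_le (range_res_le_unitSubring f _ hHgen le_sup_left)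
    (range_res_le_unitSubring f _ hHgen' le_sup_right)

end Intersection

end TropicalCharts

namespace TropicalCharts

/-! ### Openness in `X^an` tested on affine open subsets -/

section Topology

variable {K : Type u} [NontriviallyNormedField K] {X : Scheme.{u}}

/-- The map sending a point of `U^an` to the associated seminorm on `𝒪(U)`. -/
def seminormMap (f : X ⟶ Spec (CommRingCat.of K)) (U : X.Opens) (p : anOpen f U) :
    Γ(X, U) → ℝ :=
  fun g => Analytification.seminorm p g

/-- `W ∩ U^an` is open for the topology of `U^an` generated by the functions on `U`. -/
def IsOpenIn (f : X ⟶ Spec (CommRingCat.of K)) (U : X.Opens) (W : Set (Analytification f)) : Prop :=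
  ∃ O : Set (Γ(X, U) → ℝ), IsOpen O ∧ ∀ p : anOpen f U, p.1 ∈ W ↔ seminormMap f U p ∈ O

theorem isOpen_iff_isOpenIn {f : X ⟶ Spec (CommRingCat.of K)} {W : Set (Analytification f)} :
    IsOpen W ↔ ∀ U : X.Opens, IsAffineOpen U → IsOpenIn f U W := by
  have h1 : IsOpen W ↔ ∀ U : X.affineOpens, @IsOpen _ (affineTopology f U.1) (Subtype.val ⁻¹' W) := by
    refine isOpen_iSup_iff.trans (forall_congr' fun U => ?_)
    exact isOpen_coinduced (t := affineTopology f U.1)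
  have h2 : ∀ U : X.Opens, @IsOpen _ (affineTopology f U) (Subtype.val ⁻¹' W) ↔ IsOpenIn f U W := by
    intro U
    refine isOpen_induced_iff.trans (exists_congr fun O => and_congr_right fun _ => ?_)
    rw [Set.ext_iff]
    exact forall_congr' fun p => iff_comm
  exact h1.trans ⟨fun h U hU => (h2 U).1 (h ⟨U, hU⟩), fun h U => (h2 U.1).2 (h U.1 U.2)⟩

theorem IsOpenIn.of_le {f : X ⟶ Spec (CommRingCat.of K)} {U D : X.Opens} (hD : D ≤ U)
    {W : Set (Analytification f)} (hW : IsOpenIn f U W) : IsOpenIn f D W := by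
  obtain ⟨O, hO, h⟩ := hW
  refine ⟨(fun q g => q (res hD g)) ⁻¹' O, hO.preimage (by fun_prop), fun p => ?_⟩
  rw [h ⟨p.1, hD p.2⟩, Set.mem_preimage]
  have : seminormMap f U ⟨p.1, hD p.2⟩ = fun g => seminormMap f D p (res hD g) := by
    ext g
    exact (seminorm_res hD p g).symm
  rw [this]

/-- The equation `D = X.basicOpen h` is kept as a hypothesis because one `D` will be basic in two
different affine open subsets. -/
theorem exists_mul_res_pow_eq {U D : X.Opens} (hU : IsAffineOpen U) (hD : D ≤ U) (h : Γ(X, U))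
    (hDh : D = X.basicOpen h) (g : Γ(X, D)) :
    ∃ (a : Γ(X, U)) (n : ℕ), g * res hD h ^ n = res hD a := by
  subst hDh
  have := hU.isLocalization_basicOpen h
  obtain ⟨⟨a, ⟨_, n, rfl⟩⟩, ha⟩ := IsLocalization.surj (Submonoid.powers h) g
  refine ⟨a, n, ?_⟩
  rw [← map_pow]
  exact ha

/-- Functions on `D` are fractions `a / h ^ n`, so on `D^an` their absolute values are continuous in
those of functions on `U`; moreover `D^an` is the open locus `|h| ≠ 0`. -/
theorem IsOpenIn.inter_basicOpen {f : X ⟶ Spec (CommRingCat.of K)} {U D : X.Opens}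
    (hU : IsAffineOpen U) (h : Γ(X, U)) (hDh : D = X.basicOpen h)
    {W : Set (Analytification f)} (hW : IsOpenIn f D W) : IsOpenIn f U (W ∩ anOpen f D) := by
  have hD : D ≤ U := hDh ▸ X.basicOpen_le h
  choose a n han using exists_mul_res_pow_eq hU hD h hDh
  obtain ⟨O, hO, hp⟩ := hW
  have hcont : ContinuousOn (fun (q : Γ(X, U) → ℝ) (g : Γ(X, D)) => q (a g) / q h ^ n g)
      {q | q h ≠ 0} := by
    refine continuousOn_pi.2 fun g => ContinuousOn.div ?_ ?_ fun q hq => pow_ne_zero _ hq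
    · exact (continuous_apply _).continuousOn
    · exact ((continuous_apply _).pow _).continuousOn
  refine ⟨_, hcont.isOpen_inter_preimage (isOpen_ne_fun (continuous_apply h) continuous_const) hO,
    fun p => ?_⟩
  have hmem : p.1 ∈ anOpen f D ↔ seminormMap f U p h ≠ 0 := by
    rw [seminormMap, Ne, seminorm_eq_zero_iff, not_not, ← hDh]
    rfl
  rw [Set.mem_inter_iff, Set.mem_inter_iff, and_comm, hmem]
  refine and_congr_right fun hne => ?_
  rw [hp ⟨p.1, hmem.2 hne⟩, Set.mem_preimage]
  suffices seminormMap f D ⟨p.1, hmem.2 hne⟩ =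
      fun g => seminormMap f U p (a g) / seminormMap f U p h ^ n g by rw [this]
  ext g
  rw [eq_div_iff (pow_ne_zero _ hne)]
  have := congrArg (Analytification.seminorm (⟨p.1, hmem.2 hne⟩ : anOpen f D)) (han g)
  rwa [seminorm_mul, seminorm_pow, seminorm_res, seminorm_res] at this

/-- The glued topology asks for a test on every affine `U'`; one chart suffices, since `U ∩ U'` is
covered by open subsets that are basic both in `U` and in `U'`. -/
theorem IsOpenIn.isOpen {f : X ⟶ Spec (CommRingCat.of K)} {U : X.Opens} (hU : IsAffineOpen U)
    {W : Set (Analytification f)} (hWU : W ⊆ anOpen f U) (hW : IsOpenIn f U W) : IsOpen W := by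
  rw [isOpen_iff_isOpenIn]
  intro U' hU'
  have key : ∀ p : anOpen f U', p.1 ∈ W → ∃ W' ⊆ W, p.1 ∈ W' ∧ IsOpenIn f U' W' := by
    intro p hp
    obtain ⟨g, g', hgg, hx⟩ := exists_basicOpen_le_affine_inter hU hU' p.1.point ⟨hWU hp, p.2⟩
    exact ⟨W ∩ anOpen f (X.basicOpen g), Set.inter_subset_left, ⟨hp, hx⟩,
      (hW.of_le (X.basicOpen_le g)).inter_basicOpen hU' g' hgg⟩
  choose! W' hW'W hpW' O hO hOW' using key
  refine ⟨⋃ p : {p : anOpen f U' // p.1 ∈ W}, O p.1, isOpen_iUnion fun p => hO _ p.2, fun p => ?_⟩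
  rw [Set.mem_iUnion]
  constructor
  · exact fun h => ⟨⟨p, h⟩, (hOW' p h p).1 (hpW' p h)⟩
  · rintro ⟨⟨q, hq⟩, hpq⟩
    exact hW'W q hq ((hOW' q hq p).2 hpq)

end Topology

/-! ### Points as multiplicative seminorms; compact subsets of `U^an` -/

section Compactness

/-- A multiplicative seminorm on a ring induces an absolute value on the residue field of
its kernel. -/
theorem exists_absoluteValue_eq {A k : Type*} [CommRing A] [Field k] (e : A →+* k)
    (he : ∀ z : k, ∃ a b, e b ≠ 0 ∧ z * e b = e a) (q : A → ℝ) (q_nonneg : ∀ a, 0 ≤ q a)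
    (q_mul : ∀ a b, q (a * b) = q a * q b) (q_add : ∀ a b, q (a + b) ≤ q a + q b)
    (hq : ∀ a, q a = 0 ↔ e a = 0) : ∃ v : AbsoluteValue k ℝ, ∀ a, v (e a) = q a := by
  -- Subadditivity makes `q` constant on the fibres of `e`: changing `a` by an element of the kernel
  -- does not affect `q a`.
  have q_congr : ∀ a b, e a = e b → q a = q b := by
    have : ∀ a b, e a = e b → q a ≤ q b := by
      intro a b hab
      have h1 : q (a - b) = 0 := (hq _).2 (by rw [map_sub, hab, sub_self])
      have h2 := q_add (a - b) b
      rw [sub_add_cancel, h1, zero_add] at h2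
      exact h2
    exact fun a b hab => le_antisymm (this a b hab) (this b a hab.symm)
  choose num den hden hnum using he
  let v : k → ℝ := fun z => q (num z) / q (den z)
  -- The quotient `q a / q b` is independent of the fraction representing `z`, so any convenient
  -- fraction may be used for products and sums.
  have hv : ∀ z a b, e b ≠ 0 → z * e b = e a → v z * q b = q a := by
    intro z a b hb hz
    have h1 : q (den z) ≠ 0 := fun h => hden z ((hq _).1 h)
    rw [div_mul_eq_mul_div, div_eq_iff h1, ← q_mul, ← q_mul]
    apply q_congr
    rw [map_mul, map_mul, ← hz, ← hnum z]
    ring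
  have hpos : ∀ b, e b ≠ 0 → 0 < q b := fun b hb =>
    lt_of_le_of_ne (q_nonneg b) fun h => hb ((hq b).1 h.symm)
  have q_one : q 1 = 1 := by
    have h1 := q_mul 1 1
    rw [mul_one] at h1
    have h2 := hpos 1 (by simp)
    exact mul_left_cancel₀ h2.ne' (by rw [← h1, mul_one])
  refine ⟨⟨⟨v, fun x y => ?_⟩, fun x => ?_, fun x => ?_, fun x y => ?_⟩, fun a => ?_⟩
  · have h := hv (x * y) (num x * num y) (den x * den y)
      (by rw [map_mul]; exact mul_ne_zero (hden x) (hden y))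
      (by rw [map_mul, map_mul, ← hnum x, ← hnum y]; ring)
    have hx := hpos _ (hden x)
    have hy := hpos _ (hden y)
    rw [q_mul, q_mul] at h
    simp only [v] at h ⊢
    field_simp at h ⊢
    linarith
  · exact div_nonneg (q_nonneg _) (q_nonneg _)
  · have hx := hpos _ (hden x)
    change q (num x) / q (den x) = 0 ↔ _
    rw [div_eq_zero_iff, or_iff_left hx.ne', hq, ← hnum x, mul_eq_zero, or_iff_left (hden x)]
  · have hx := hpos _ (hden x)
    have hy := hpos _ (hden y)
    have h := hv (x + y) (num x * den y + num y * den x) (den x * den y)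
      (by rw [map_mul]; exact mul_ne_zero (hden x) (hden y))
      (by simp only [map_mul, map_add]; rw [← hnum x, ← hnum y]; ring)
    have h2 := q_add (num x * den y) (num y * den x)
    simp only [q_mul] at h h2
    rw [← h] at h2
    change v (x + y) ≤ q (num x) / q (den x) + q (num y) / q (den y)
    rw [div_add_div _ _ hx.ne' hy.ne', le_div_iff₀ (mul_pos hx hy)]
    linarith
  · have h := hv (e a) a 1 (by simp) (by simp)
    rwa [q_one, mul_one] at h

variable {K : Type u} [NontriviallyNormedField K] {X : Scheme.{u}}

/-- The stalk at `x` is a localization of `𝒪(U)`, so its quotient, the residue field, consists of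
fractions of values of functions. -/
theorem exists_evaluation_eq_div {U : X.Opens} (hU : IsAffineOpen U) (x : X) (hx : x ∈ U)
    (z : X.residueField x) : ∃ a b : Γ(X, U), X.evaluation U x hx b ≠ 0 ∧
      z * X.evaluation U x hx b = X.evaluation U x hx a := by
  obtain ⟨y, rfl⟩ := X.residue_surjective x z
  have := hU.isLocalization_stalk ⟨x, hx⟩
  let _ : Algebra Γ(X, U) (X.presheaf.stalk x) := (X.presheaf.germ U x hx).hom.toAlgebra
  obtain ⟨⟨a, b⟩, hab⟩ := IsLocalization.surj
    (hU.primeIdealOf ⟨x, hx⟩).asIdeal.primeCompl y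
  have hb : IsUnit (X.presheaf.germ U x hx b.1) :=
    IsLocalization.map_units (X.presheaf.stalk x) b
  refine ⟨a, b.1, (hb.map (X.residue x).hom).ne_zero, ?_⟩
  have h2 := congrArg (X.residue x) hab
  rw [map_mul] at h2
  exact h2

/-- The kernel of `q` is a prime ideal and hence a point of `U`; `q` descends to an absolute value
on its residue field. -/
theorem exists_seminormMap_eq {f : X ⟶ Spec (CommRingCat.of K)} {U : X.Opens}
    (hU : IsAffineOpen U) (q : Γ(X, U) → ℝ) (q_nonneg : ∀ a, 0 ≤ q a)
    (q_mul : ∀ a b, q (a * b) = q a * q b) (q_add : ∀ a b, q (a + b) ≤ q a + q b)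
    (q_scalar : ∀ a, q (scalar f U a) = ‖a‖) : ∃ p : anOpen f U, seminormMap f U p = q := by
  have q_zero : q 0 = 0 := by simpa using q_scalar 0
  have q_one : q 1 = 1 := by simpa using q_scalar 1
  let P : Ideal Γ(X, U) :=
    { carrier := {a | q a = 0}
      zero_mem' := q_zero
      add_mem' := fun {a b} ha hb => le_antisymm
        ((q_add a b).trans (by rw [Set.mem_ofPred.1 ha, Set.mem_ofPred.1 hb, add_zero])) (q_nonneg _)
      smul_mem' := fun a b hb => by
        rw [Set.mem_ofPred, smul_eq_mul, q_mul, Set.mem_ofPred.1 hb, mul_zero] }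
  have hP : P.IsPrime := by
    refine ⟨fun h => ?_, fun {a b} hab => ?_⟩
    · have h1 : (1 : Γ(X, U)) ∈ P := (Ideal.eq_top_iff_one P).1 h
      exact one_ne_zero (q_one.symm.trans h1)
    · exact mul_eq_zero.1 ((q_mul a b).symm.trans hab)
  let y : Spec Γ(X, U) := ⟨P, hP⟩
  let x : X := hU.fromSpec y
  have hx : x ∈ U := by
    have h1 : x ∈ Set.range hU.fromSpec := ⟨y, rfl⟩
    rwa [hU.range_fromSpec] at h1
  have heval : ∀ a, q a = 0 ↔ (X.evaluation U x hx).hom a = 0 := by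
    intro a
    refine Iff.trans ?_ (X.evaluation_eq_zero_iff_notMem_basicOpen x hx a).symm
    have h1 : y ∈ hU.fromSpec ⁻¹ᵁ X.basicOpen a ↔ y ∈ PrimeSpectrum.basicOpen a := by
      rw [hU.fromSpec_preimage_basicOpen]
      rfl
    exact (not_not (a := a ∈ P)).symm.trans (not_iff_not.2 h1).symm
  obtain ⟨v, hv⟩ := exists_absoluteValue_eq (X.evaluation U x hx).hom
    (exists_evaluation_eq_div hU x hx) q q_nonneg q_mul q_add heval
  have hsc : ∀ a, v (X.evaluation ⊤ x trivial (scalar f ⊤ a)) = ‖a‖ := by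
    intro a
    rw [← q_scalar, ← hv, ← res_scalar f (le_top : U ≤ ⊤)]
    exact congrArg v (evaluation_res le_top x hx _).symm
  exact ⟨⟨⟨x, v, hsc⟩, hx⟩, funext hv⟩

/-- The axioms of a multiplicative seminorm extending the norm of `K` are closed conditions, each
involving finitely many coordinates. -/
theorem isClosed_range_seminormMap {f : X ⟶ Spec (CommRingCat.of K)} {U : X.Opens}
    (hU : IsAffineOpen U) : IsClosed (Set.range (seminormMap f U)) := by
  have : Set.range (seminormMap f U) = {q | ∀ a, 0 ≤ q a} ∩ {q | ∀ a b, q (a * b) = q a * q b} ∩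
      {q | ∀ a b, q (a + b) ≤ q a + q b} ∩ {q | ∀ a, q (scalar f U a) = ‖a‖} := by
    apply Set.Subset.antisymm
    · rintro _ ⟨p, rfl⟩
      exact ⟨⟨⟨seminorm_nonneg p, seminorm_mul p⟩, seminorm_add_le p⟩, seminorm_scalar p⟩
    · rintro q ⟨⟨⟨h1, h2⟩, h3⟩, h4⟩
      exact exists_seminormMap_eq hU q h1 h2 h3 h4
  rw [this]
  simp only [Set.ofPred_forall]
  refine ((IsClosed.inter ?_ ?_).inter ?_).inter ?_
  · exact isClosed_iInter fun a => isClosed_le continuous_const (continuous_apply a)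
  · exact isClosed_iInter fun a => isClosed_iInter fun b =>
      isClosed_eq (continuous_apply _) ((continuous_apply a).mul (continuous_apply b))
  · exact isClosed_iInter fun a => isClosed_iInter fun b =>
      isClosed_le (continuous_apply _) ((continuous_apply a).add (continuous_apply b))
  · exact isClosed_iInter fun a => isClosed_eq (continuous_apply _) continuous_const

/-- Closed subsets of `U^an` on which all functions on `U` are bounded are compact. -/
theorem isCompact_of_forall_bounded {f : X ⟶ Spec (CommRingCat.of K)} {U : X.Opens}
    (hU : IsAffineOpen U) {C : Set (Γ(X, U) → ℝ)} (hC : IsClosed C)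
    (hbdd : ∀ g, ∃ B, ∀ p, seminormMap f U p ∈ C → Analytification.seminorm p g ≤ B) :
    @IsCompact _ (affineTopology f U) (seminormMap f U ⁻¹' C) := by
  let _ := affineTopology f U
  have hind : Topology.IsInducing (seminormMap f U) := ⟨rfl⟩
  rw [hind.isCompact_iff, Set.image_preimage_eq_inter_range]
  choose B hB using hbdd
  -- Tychonoff: the set is closed in the product of the intervals `[0, B g]`.
  refine IsCompact.of_isClosed_subset (isCompact_univ_pi fun g => isCompact_Icc (a := 0) (b := B g))
    (hC.inter (isClosed_range_seminormMap hU)) ?_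
  rintro _ ⟨hp, ⟨p, rfl⟩⟩ g -
  exact ⟨seminorm_nonneg p g, hB g p hp⟩

/-- If `𝒪(U)` is generated by the units in `H`, then every function on `U` is bounded
on any set on which all elements of `H` are bounded. -/
theorem bounded_of_unitSubring_eq_top {f : X ⟶ Spec (CommRingCat.of K)} {U : X.Opens}
    {H : Subgroup Γ(X, U)ˣ} (hH : unitSubring f U H = ⊤) {C : Set (anOpen f U)}
    (hbdd : ∀ u ∈ H, ∃ B, ∀ p ∈ C, Analytification.seminorm p (u : Γ(X, U)) ≤ B) (g : Γ(X, U)) :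
    ∃ B, ∀ p ∈ C, Analytification.seminorm p g ≤ B := by
  have hg : g ∈ unitSubring f U H := hH ▸ Subring.mem_top g
  induction hg using Subring.closure_induction with
  | mem x hx =>
    obtain ⟨a, rfl⟩ | ⟨u, hu, rfl⟩ := hx
    · exact ⟨‖a‖, fun p _ => (seminorm_scalar p a).le⟩
    · exact hbdd u hu
  | zero => exact ⟨0, fun p _ => (seminorm_zero p).le⟩
  | one => exact ⟨1, fun p _ => (seminorm_one p).le⟩
  | add x y _ _ hx hy =>
    obtain ⟨B, hB⟩ := hx
    obtain ⟨B', hB'⟩ := hy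
    exact ⟨B + B', fun p hp => (seminorm_add_le p x y).trans (add_le_add (hB p hp) (hB' p hp))⟩
  | neg x _ hx =>
    obtain ⟨B, hB⟩ := hx
    exact ⟨B, fun p hp => (seminorm_neg p x).le.trans (hB p hp)⟩
  | mul x y _ _ hx hy =>
    obtain ⟨B, hB⟩ := hx
    obtain ⟨B', hB'⟩ := hy
    refine ⟨B * B', fun p hp => (seminorm_mul p x y).le.trans ?_⟩
    exact mul_le_mul (hB p hp) (hB' p hp) (seminorm_nonneg p y)
      ((seminorm_nonneg p x).trans (hB p hp))

theorem seminorm_inv {f : X ⟶ Spec (CommRingCat.of K)} {U : X.Opens} (p : anOpen f U)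
    (u : Γ(X, U)ˣ) : Analytification.seminorm p ((u⁻¹ : Γ(X, U)ˣ) : Γ(X, U)) =
      (Analytification.seminorm p (u : Γ(X, U)))⁻¹ := by
  apply eq_inv_of_mul_eq_one_left
  rw [← seminorm_mul, Units.inv_mul, seminorm_one]

/-- Positive lower bounds are carried through the induction because inverses turn them into upper
bounds. -/
theorem bounded_of_mem_closure {f : X ⟶ Spec (CommRingCat.of K)} {U : X.Opens}
    {T : Set Γ(X, U)ˣ} {C : Set (anOpen f U)}
    (hT : ∀ u ∈ T, ∃ b B, 0 < b ∧ ∀ p ∈ C, b ≤ Analytification.seminorm p (u : Γ(X, U)) ∧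
      Analytification.seminorm p (u : Γ(X, U)) ≤ B) {u : Γ(X, U)ˣ} (hu : u ∈ Subgroup.closure T) :
    ∃ B, ∀ p ∈ C, Analytification.seminorm p (u : Γ(X, U)) ≤ B := by
  suffices ∃ b B, 0 < b ∧ ∀ p ∈ C, b ≤ Analytification.seminorm p (u : Γ(X, U)) ∧
      Analytification.seminorm p (u : Γ(X, U)) ≤ B by
    obtain ⟨b, B, -, h⟩ := this
    exact ⟨B, fun p hp => (h p hp).2⟩
  induction hu using Subgroup.closure_induction with
  | mem x hx => exact hT x hx
  | one => exact ⟨1, 1, one_pos, fun p _ => ⟨(seminorm_one p).ge, (seminorm_one p).le⟩⟩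
  | mul x y _ _ hx hy =>
    obtain ⟨b, B, hb, h⟩ := hx
    obtain ⟨b', B', hb', h'⟩ := hy
    refine ⟨b * b', B * B', mul_pos hb hb', fun p hp => ?_⟩
    rw [Units.val_mul, seminorm_mul]
    exact ⟨mul_le_mul (h p hp).1 (h' p hp).1 hb'.le (seminorm_nonneg _ _),
      mul_le_mul (h p hp).2 (h' p hp).2 (seminorm_nonneg _ _)
        ((seminorm_nonneg _ _).trans (h p hp).2)⟩
  | inv x _ hx =>
    obtain ⟨b, B, hb, h⟩ := hx
    -- If `C` is empty, `B` may fail to be positive; `max B 1` keeps the new lower bound positive.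
    refine ⟨(max B 1)⁻¹, b⁻¹, by positivity, fun p hp => ?_⟩
    have hpos := hb.trans_le (h p hp).1
    rw [seminorm_inv]
    exact ⟨inv_anti₀ hpos ((h p hp).2.trans (le_max_left _ _)), inv_anti₀ hb (h p hp).1⟩

end Compactness

end TropicalCharts

namespace TropicalCharts

/-! ### Units and the functoriality of tropicalization -/

section Tropicalization

variable {K : Type u} [NontriviallyNormedField K] {X : Scheme.{u}}
  {f : X ⟶ Spec (CommRingCat.of K)} {U : X.Opens}

/-- The homomorphism `M → ℝ` underlying a point of `N_ℝ`. -/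
def CocharacterSpace.value {M : Type u} [CommGroup M] (n : CocharacterSpace M) : Additive M →+ ℝ :=
  n

theorem continuous_cocharacterSpace_apply {M : Type u} [CommGroup M] (m : Additive M) :
    Continuous (fun n : CocharacterSpace M => n.value m) :=
  (continuous_apply m).comp continuous_induced_dom

instance (M : Type u) [CommGroup M] : T2Space (CocharacterSpace M) :=
  T2Space.of_injective_continuous (f := fun (n : CocharacterSpace M) (m : Additive M) =>
    n.value m) (DFunLike.coe_injective (F := Additive M →+ ℝ)) continuous_induced_dom

theorem MomentMap.trop_apply {M : Type u} [CommGroup M] (φ : MomentMap f U M) (p : anOpen f U)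
    (m : Additive M) : (φ.trop p).value m =
      -Real.log (Analytification.seminorm p (φ.character m.toMul : Γ(X, U))) := rfl

theorem MomentMap.continuous_trop {M : Type u} [CommGroup M] (φ : MomentMap f U M) :
    @Continuous _ _ (affineTopology f U) _ φ.trop := by
  let _ := affineTopology f U
  refine continuous_induced_rng.2 (continuous_pi fun m => ?_)
  have h1 : Continuous (seminormMap f U) := continuous_induced_dom
  exact (((continuous_apply _).comp h1).log fun p => seminorm_unit_ne_zero p _).neg

theorem CanonicalMomentMap.exists_eq_scalar_mul_character (φ : CanonicalMomentMap f U)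
    (u : Γ(X, U)ˣ) : ∃ c : Kˣ, (u : Γ(X, U)) =
      scalar f U c * φ.character (u : unitLattice f U) := by
  obtain ⟨c, hc⟩ := QuotientGroup.eq.1 (φ.character_eq (u : unitLattice f U))
  refine ⟨c, ?_⟩
  rw [eq_inv_mul_iff_mul_eq] at hc
  have h := congrArg Units.val hc
  rw [Units.val_mul, mul_comm] at h
  exact h.symm

/-- The values of units are determined by the tropicalization. -/
theorem CanonicalMomentMap.exists_seminorm_unit_eq (φ : CanonicalMomentMap f U)
    (u : Γ(X, U)ˣ) : ∃ c : ℝ, 0 < c ∧ ∀ p : anOpen f U,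
      Analytification.seminorm p (u : Γ(X, U)) = c * Real.exp
        (-(φ.trop p).value
          (Additive.ofMul (u : unitLattice f U))) := by
  obtain ⟨c, hc⟩ := φ.exists_eq_scalar_mul_character u
  refine ⟨‖(c : K)‖, norm_pos_iff.2 c.ne_zero, fun p => ?_⟩
  rw [MomentMap.trop_apply, neg_neg, Real.exp_log
    (lt_of_le_of_ne (seminorm_nonneg _ _) (seminorm_unit_ne_zero p _).symm)]
  have h := congrArg (Analytification.seminorm p) hc
  rwa [seminorm_mul, seminorm_scalar] at h

/-- For `V ≤ U` the tropicalization of `U` factors continuously through that of `V`. -/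
theorem CanonicalMomentMap.exists_continuous_factor (φ : CanonicalMomentMap f U) {V : X.Opens}
    (h : V ≤ U) (ψ : CanonicalMomentMap f V) :
    ∃ F : CocharacterSpace (unitLattice f V) → (Additive (unitLattice f U) → ℝ), Continuous F ∧
      ∀ p : anOpen f V, F (ψ.trop p) = fun m =>
        (φ.trop ⟨p.1, h p.2⟩).value m := by
  choose c hc hcp using fun m : Additive (unitLattice f U) =>
    ψ.exists_seminorm_unit_eq (resUnits h (φ.character m.toMul))
  -- The map is affine: the character `m` of `U` restricts to a unit on `V`, which is a scalar of
  -- norm `c m` times a character of `V`. Values are taken in all functions, so additivity in `m`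
  -- need not be checked.
  refine ⟨fun n m => -Real.log (c m) + n.value
    (Additive.ofMul (resUnits h (φ.character m.toMul) : unitLattice f V)), ?_, fun p => ?_⟩
  · exact continuous_pi fun m => continuous_const.add (continuous_cocharacterSpace_apply _)
  · ext m
    rw [MomentMap.trop_apply, ← seminorm_res h p, ← coe_resUnits, hcp m p,
      Real.log_mul (hc m).ne' (Real.exp_ne_zero _), Real.log_exp]
    ring

theorem CanonicalMomentMap.exists_isOpen_preimage_of_le (φ : CanonicalMomentMap f U)
    {V : X.Opens} (h : V ≤ U) (ψ : CanonicalMomentMap f V) {Ω : Set φ.Trop} (hΩ : IsOpen Ω) :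
    ∃ Ω' : Set ψ.Trop, IsOpen Ω' ∧
      ∀ p : anOpen f V, ψ.tropU p ∈ Ω' ↔ φ.tropU ⟨p.1, h p.2⟩ ∈ Ω := by
  obtain ⟨O, hO, rfl⟩ := isOpen_induced_iff.1 hΩ
  obtain ⟨O', hO', rfl⟩ := isOpen_induced_iff.1 hO
  obtain ⟨F, hF, hFp⟩ := φ.exists_continuous_factor h ψ
  refine ⟨(fun n => F n.1) ⁻¹' O', hO'.preimage (hF.comp continuous_subtype_val), fun p => ?_⟩
  have h1 : (ψ.tropU p).1 = ψ.trop p := rfl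
  rw [Set.mem_preimage, h1, hFp]
  rfl

theorem mem_image_tropU_preimage {φ : CanonicalMomentMap f U} {Ω : Set φ.Trop}
    {p : Analytification f} : p ∈ Subtype.val '' (φ.tropU ⁻¹' Ω) ↔
      ∃ hp : p ∈ anOpen f U, φ.tropU ⟨p, hp⟩ ∈ Ω := by
  constructor
  · rintro ⟨q, hq, rfl⟩
    exact ⟨q.2, hq⟩
  · rintro ⟨hp, h⟩
    exact ⟨⟨p, hp⟩, h, rfl⟩

end Tropicalization

/-! ### Intersections and shrinking of tropical charts -/

section Subcharts

variable {K : Type u} [NontriviallyNormedField K] {X : Scheme.{u}}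
  {f : X ⟶ Spec (CommRingCat.of K)} {U U' : X.Opens}

theorem IsTropicalChart.inter {V V' : Set (Analytification f)} {φ : CanonicalMomentMap f U}
    {φ' : CanonicalMomentMap f U'} (hV : IsTropicalChart V φ) (hV' : IsTropicalChart V' φ')
    (h : IsVeryAffine f (U ⊓ U')) (ψ : CanonicalMomentMap f (U ⊓ U')) :
    IsTropicalChart (V ∩ V') ψ := by
  obtain ⟨Ω, hΩ, hVΩ⟩ := hV.exists_preimage
  obtain ⟨Ω', hΩ', hVΩ'⟩ := hV'.exists_preimage
  obtain ⟨O, hO, hOp⟩ := φ.exists_isOpen_preimage_of_le inf_le_left ψ hΩ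
  obtain ⟨O', hO', hOp'⟩ := φ'.exists_isOpen_preimage_of_le inf_le_right ψ hΩ'
  refine ⟨h, hV.isOpen.inter hV'.isOpen, fun p hp => ⟨hV.subset hp.1, hV'.subset hp.2⟩,
    O ∩ O', hO.inter hO', ?_⟩
  ext p
  rw [hVΩ, hVΩ', Set.mem_inter_iff, mem_image_tropU_preimage, mem_image_tropU_preimage,
    mem_image_tropU_preimage]
  constructor
  · rintro ⟨⟨hp, h1⟩, ⟨hp', h2⟩⟩
    exact ⟨⟨hp, hp'⟩, (hOp ⟨p, ⟨hp, hp'⟩⟩).2 h1, (hOp' ⟨p, ⟨hp, hp'⟩⟩).2 h2⟩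
  · rintro ⟨hp, h1, h2⟩
    exact ⟨⟨hp.1, (hOp ⟨p, hp⟩).1 h1⟩, ⟨hp.2, (hOp' ⟨p, hp⟩).1 h2⟩⟩

theorem IsTropicalChart.of_le {V : Set (Analytification f)} {φ : CanonicalMomentMap f U}
    (hV : IsTropicalChart V φ) (hle : U' ≤ U) (h : IsVeryAffine f U') (hVU' : V ⊆ anOpen f U')
    (ψ : CanonicalMomentMap f U') : IsTropicalChart V ψ := by
  obtain ⟨Ω, hΩ, hVΩ⟩ := hV.exists_preimage
  obtain ⟨O, hO, hOp⟩ := φ.exists_isOpen_preimage_of_le hle ψ hΩ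
  refine ⟨h, hV.isOpen, hVU', O, hO, ?_⟩
  ext p
  rw [mem_image_tropU_preimage]
  constructor
  · intro hp
    refine ⟨hVU' hp, (hOp _).2 ?_⟩
    rw [hVΩ, mem_image_tropU_preimage] at hp
    exact hp.2
  · rintro ⟨hp, h1⟩
    rw [hVΩ, mem_image_tropU_preimage]
    exact ⟨hle hp, (hOp ⟨p, hp⟩).1 h1⟩

end Subcharts

/-! ### Neighbourhood bases of tropical charts -/

section Basis

variable {K : Type u} [NontriviallyNormedField K] {X : Scheme.{u}}
  {f : X ⟶ Spec (CommRingCat.of K)} {U : X.Opens}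

/-- The points of `U^an` at which the values of the units in `T` are close to prescribed ones. -/
def unitBox (f : X ⟶ Spec (CommRingCat.of K)) (U : X.Opens) (T : Set Γ(X, U)ˣ)
    (r δ : Γ(X, U)ˣ → ℝ) : Set (Analytification f) :=
  Subtype.val '' {p : anOpen f U | ∀ u ∈ T,
    |Analytification.seminorm p (u : Γ(X, U)) - r u| < δ u}

theorem mem_unitBox {T : Set Γ(X, U)ˣ} {r δ : Γ(X, U)ˣ → ℝ} {p : Analytification f} :
    p ∈ unitBox f U T r δ ↔ ∃ hp : p ∈ anOpen f U, ∀ u ∈ T,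
      |Analytification.seminorm (⟨p, hp⟩ : anOpen f U) (u : Γ(X, U)) - r u| < δ u := by
  constructor
  · rintro ⟨q, hq, rfl⟩
    exact ⟨q.2, hq⟩
  · rintro ⟨hp, h⟩
    exact ⟨⟨p, hp⟩, h, rfl⟩

theorem isTropicalChart_unitBox (hU : IsVeryAffine f U) (φ : CanonicalMomentMap f U)
    {T : Set Γ(X, U)ˣ} (hT : T.Finite) (r δ : Γ(X, U)ˣ → ℝ) :
    IsTropicalChart (unitBox f U T r δ) φ := by
  have hsub : unitBox f U T r δ ⊆ anOpen f U := fun p hp => (mem_unitBox.1 hp).1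
  refine ⟨hU, ?_, hsub, ?_⟩
  · refine IsOpenIn.isOpen (isVeryAffine_iff.1 hU).1 hsub
      ⟨⋂ u ∈ T, {q | |q (u : Γ(X, U)) - r u| < δ u}, ?_, fun p => ?_⟩
    · exact hT.isOpen_biInter fun u _ =>
        isOpen_lt ((continuous_apply _).sub continuous_const).abs continuous_const
    · rw [mem_unitBox, Set.mem_iInter₂]
      exact ⟨fun h => h.2, fun h => ⟨p.2, h⟩⟩
  · choose c hc hcp using φ.exists_seminorm_unit_eq
    refine ⟨⋂ u ∈ T, {n : φ.Trop | |c u * Real.exp (-n.1.value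
      (Additive.ofMul (u : unitLattice f U))) - r u| < δ u}, ?_, ?_⟩
    · refine hT.isOpen_biInter fun u _ => isOpen_lt ?_ continuous_const
      have h1 := (continuous_cocharacterSpace_apply
        (Additive.ofMul (u : unitLattice f U))).comp (continuous_subtype_val (p := (· ∈ φ.Trop)))
      exact ((continuous_const.mul h1.neg.rexp).sub continuous_const).abs
    · ext p
      rw [mem_unitBox, mem_image_tropU_preimage]
      refine exists_congr fun hp => ?_
      rw [Set.mem_iInter₂]
      refine forall₂_congr fun u _ => ?_
      rw [hcp u ⟨p, hp⟩]
      rfl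

theorem isOpen_tropImage {V : Set (Analytification f)} {φ : CanonicalMomentMap f U}
    (h : IsTropicalChart V φ) : IsOpen (φ.tropImage V) := by
  obtain ⟨Ω, hΩ, rfl⟩ := h.exists_preimage
  rw [CanonicalMomentMap.tropImage, Set.preimage_image_eq _ Subtype.val_injective,
    Set.image_preimage_eq Ω (f := φ.tropU) Set.rangeFactorization_surjective]
  exact hΩ

/-- Since `δ < r`, the closed box keeps the generating units bounded and away from `0`. All
functions are then bounded on it, so it is compact, and its image, being compact in a Hausdorff
space, is closed. -/
theorem isCompact_closure_tropImage_unitBox (hU : IsAffineOpen U) (φ : CanonicalMomentMap f U)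
    {T : Set Γ(X, U)ˣ} (hT : unitSubring f U (Subgroup.closure T) = ⊤) {r δ : Γ(X, U)ˣ → ℝ}
    (hδ : ∀ u ∈ T, δ u < r u) : IsCompact (closure (φ.tropImage (unitBox f U T r δ))) := by
  let C : Set (Γ(X, U) → ℝ) := ⋂ u ∈ T, {q | |q (u : Γ(X, U)) - r u| ≤ δ u}
  have hC : IsClosed C := isClosed_biInter fun u _ =>
    isClosed_le ((continuous_apply _).sub continuous_const).abs continuous_const
  have hcomp : @IsCompact _ (affineTopology f U) (seminormMap f U ⁻¹' C) := by
    refine isCompact_of_forall_bounded hU hC fun g =>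
      bounded_of_unitSubring_eq_top (C := seminormMap f U ⁻¹' C) hT (fun u hu => ?_) g
    refine bounded_of_mem_closure (fun v hv => ⟨r v - δ v, r v + δ v, sub_pos.2 (hδ v hv),
      fun p hp => ?_⟩) hu
    have h1 : |Analytification.seminorm p (v : Γ(X, U)) - r v| ≤ δ v := Set.mem_iInter₂.1 hp v hv
    rw [abs_le] at h1
    constructor <;> linarith
  have htrop : @Continuous _ _ (affineTopology f U) _ φ.tropU :=
    @Continuous.subtype_mk _ _ _ (affineTopology f U) _ _ φ.continuous_trop fun p => ⟨p, rfl⟩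
  have himage : IsCompact (φ.tropU '' (seminormMap f U ⁻¹' C)) :=
    @IsCompact.image _ _ (affineTopology f U) _ _ _ hcomp htrop
  refine himage.of_isClosed_subset isClosed_closure (closure_minimal ?_ himage.isClosed)
  refine Set.image_mono fun p hp => ?_
  obtain ⟨_, h⟩ := mem_unitBox.1 hp
  exact Set.mem_iInter₂.2 fun u hu => (h u hu).le

theorem exists_finite_closure_eq_top (f : X ⟶ Spec (CommRingCat.of K)) [LocallyOfFiniteType f]
    (hU : IsAffineOpen U) : ∃ S : Set Γ(X, U), S.Finite ∧
      Subring.closure (Set.range (scalar f U) ∪ S) = ⊤ := by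
  have h1 : (f.appLE ⊤ U le_top).hom.FiniteType :=
    LocallyOfFiniteType.finiteType_appLE f (isAffineOpen_top _) hU _
  have h2 : (scalar f U).FiniteType :=
    h1.comp (RingHom.FiniteType.of_surjective _
      (ConcreteCategory.bijective_of_isIso (Scheme.ΓSpecIso (CommRingCat.of K)).inv).surjective)
  let _ := (scalar f U).toAlgebra
  obtain ⟨S, hS⟩ := (h2 : Algebra.FiniteType K Γ(X, U)).out
  refine ⟨S, S.finite_toSet, ?_⟩
  have h3 := congrArg Subalgebra.toSubring hS
  rwa [Algebra.adjoin_eq_ring_closure] at h3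

/-- If `g` vanishes at `p`, any nonzero constant works, and nontriviality of the norm provides
arbitrarily small ones. -/
theorem exists_seminorm_add_scalar_ne_zero (p : anOpen f U) (g : Γ(X, U)) {ε : ℝ} (hε : 0 < ε) :
    ∃ c : K, ‖c‖ < ε ∧ Analytification.seminorm p (g + scalar f U c) ≠ 0 := by
  by_cases h : Analytification.seminorm p g = 0
  · obtain ⟨c, hc0, hc⟩ := NormedField.exists_norm_lt K hε
    refine ⟨c, hc, fun h1 => ?_⟩
    have h2 := seminorm_add_le p (g + scalar f U c) (-g)
    rw [add_neg_cancel_comm, seminorm_neg, h, h1, seminorm_scalar, add_zero] at h2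
    exact hc0.not_ge h2
  · exact ⟨0, by simpa using hε, by simpa using h⟩

theorem abs_seminorm_add_scalar_sub_le (p : anOpen f U) (g : Γ(X, U)) (c : K) :
    |Analytification.seminorm p (g + scalar f U c) - Analytification.seminorm p g| ≤ ‖c‖ := by
  rw [abs_le]
  have h1 := seminorm_add_le p g (scalar f U c)
  have h2 := seminorm_add_le p (g + scalar f U c) (-scalar f U c)
  rw [add_neg_cancel_right, seminorm_neg] at h2
  rw [seminorm_scalar] at h1 h2
  constructor <;> linarith

/-- Every point of `U^an` has a very affine neighbourhood `D ≤ U` on which suitable units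
approximate given functions on `U`. -/
theorem exists_units_approximating [LocallyOfFiniteType f] (hU : IsAffineOpen U) (x : anOpen f U)
    {G : Set Γ(X, U)} (hG : G.Finite) {ε : ℝ} (hε : 0 < ε) :
    ∃ (D : X.Opens) (hD : D ≤ U) (T : Set Γ(X, D)ˣ), IsAffineOpen D ∧ x.1 ∈ anOpen f D ∧
      T.Finite ∧ unitSubring f D (Subgroup.closure T) = ⊤ ∧
      ∀ g ∈ G, ∃ u ∈ T, ∀ p : anOpen f D, |Analytification.seminorm p (u : Γ(X, D)) -
        Analytification.seminorm p (res hD g)| ≤ ε := by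
  obtain ⟨S₀, hS₀, hgen⟩ := exists_finite_closure_eq_top f hU
  choose c hcε hc using fun g => exists_seminorm_add_scalar_ne_zero x g hε
  let S : Finset Γ(X, U) := (hS₀.union hG).toFinset
  have hS : ∀ g, g ∈ S ↔ g ∈ S₀ ∨ g ∈ G := fun g => by simp [S]
  -- Inverting this product turns all perturbed generators and all perturbed elements of `G` into
  -- units; no factor vanishes at `x`.
  let h : Γ(X, U) := ∏ g ∈ S, (g + scalar f U (c g))
  have hD : X.basicOpen h ≤ U := X.basicOpen_le h
  have hunit : IsUnit (res hD h) := RingedSpace.isUnit_res_basicOpen _ h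
  have hunit' : ∀ g : S, IsUnit (res hD (g.1 + scalar f U (c g.1))) := fun g =>
    isUnit_of_dvd_unit (map_dvd (res hD) (Finset.dvd_prod_of_mem (fun g => g + scalar f U (c g)) g.2)) hunit
  let v : S → Γ(X, X.basicOpen h)ˣ := fun g => (hunit' g).unit
  have hv : ∀ g : S, (v g : Γ(X, X.basicOpen h)) = res hD g.1 + scalar f _ (c g.1) := fun g => by
    rw [← res_scalar f hD, ← map_add]
    rfl
  refine ⟨X.basicOpen h, hD, Set.range v, hU.basicOpen h, ?_, Set.finite_range v, ?_, ?_⟩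
  · rw [anOpen, Set.mem_ofPred, ← not_not (a := _ ∈ X.basicOpen h), ← seminorm_eq_zero_iff x]
    have h1 : Analytification.seminorm x h =
        ∏ g ∈ S, Analytification.seminorm x (g + scalar f U (c g)) := by
      simp only [Analytification.seminorm, h, map_prod]
    rw [h1]
    exact Finset.prod_ne_zero_iff.2 fun g _ => hc g
  · have hres : (res hD).range ≤ unitSubring f _ (Subgroup.closure (Set.range v)) := by
      rw [RingHom.range_eq_map, ← hgen, RingHom.map_closure, Subring.closure_le]
      rintro _ ⟨_, (⟨a, rfl⟩ | hg), rfl⟩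
      · exact Subring.subset_closure (Or.inl ⟨a, (res_scalar f hD a).symm⟩)
      · rename_i g
        have h1 := hv ⟨g, (hS g).2 (Or.inl hg)⟩
        rw [← sub_eq_iff_eq_add] at h1
        rw [← h1]
        exact sub_mem (Subring.subset_closure (Or.inr ⟨_, Subgroup.subset_closure ⟨_, rfl⟩, rfl⟩))
          (Subring.subset_closure (Or.inl ⟨_, rfl⟩))
    have hh : hunit.unit ∈ Subgroup.closure (Set.range v) := by
      have : hunit.unit = ∏ g : S, v g := by
        ext
        rw [Units.coe_prod, IsUnit.unit_spec, map_prod, ← Finset.prod_coe_sort S]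
        rfl
      rw [this]
      exact prod_mem fun g _ => Subgroup.subset_closure ⟨g, rfl⟩
    rw [eq_top_iff]
    intro z _
    -- Write `z = a / h ^ n`: the numerator is generated by the units `v g` and scalars, and `h` is
    -- itself a product of the `v g`.
    obtain ⟨a, n, ha⟩ := exists_mul_res_pow_eq hU hD h rfl z
    have hz : z = res hD a * ((hunit.unit⁻¹ ^ n : Γ(X, X.basicOpen h)ˣ) : Γ(X, X.basicOpen h)) := by
      rw [inv_pow, Units.eq_mul_inv_iff_mul_eq, Units.val_pow_eq_pow_val, IsUnit.unit_spec, ha]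
    rw [hz]
    exact mul_mem (hres ⟨a, rfl⟩)
      (Subring.subset_closure (Or.inr ⟨_, pow_mem (inv_mem hh) n, rfl⟩))
  · intro g hg
    refine ⟨v ⟨g, (hS g).2 (Or.inr hg)⟩, ⟨_, rfl⟩, fun p => ?_⟩
    rw [hv]
    exact (abs_seminorm_add_scalar_sub_le p _ _).trans (hcε g).le

theorem exists_finite_ball_subset {ι : Type*} {O : Set (ι → ℝ)} (hO : IsOpen O) {q : ι → ℝ}
    (hq : q ∈ O) : ∃ (G : Set ι) (ε : ℝ), G.Finite ∧ 0 < ε ∧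
      ∀ q' : ι → ℝ, (∀ i ∈ G, |q' i - q i| < ε) → q' ∈ O := by
  obtain ⟨I, t, ht, hsub⟩ := isOpen_pi_iff.1 hO q hq
  have hball : ∀ i ∈ I, ∃ ε > 0, Metric.ball (q i) ε ⊆ t i := fun i hi =>
    Metric.isOpen_iff.1 (ht i hi).1 _ (ht i hi).2
  choose! e he hes using hball
  obtain ⟨ε, hε, hle⟩ : ∃ ε > 0, ∀ i ∈ I, ε ≤ e i := by
    rcases I.eq_empty_or_nonempty with rfl | hne
    · exact ⟨1, one_pos, by simp⟩
    · exact ⟨I.inf' hne e, (Finset.lt_inf'_iff hne).2 he, fun i hi => Finset.inf'_le e hi⟩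
  refine ⟨I, ε, I.finite_toSet, hε, fun q' hq' => hsub fun i hi => hes i hi ?_⟩
  rw [Metric.mem_ball, Real.dist_eq]
  exact (hq' i hi).trans_le (hle i hi)

/-- Tropical charts with relatively compact image form neighbourhood bases. -/
theorem exists_isTropicalChart_subset [IsAlgClosed K] [LocallyOfFiniteType f]
    {W : Set (Analytification f)} (hW : IsOpen W) {x : Analytification f} (hx : x ∈ W) :
    ∃ (U : X.Opens) (φ : CanonicalMomentMap f U) (V : Set (Analytification f)),
      IsTropicalChart V φ ∧ x ∈ V ∧ V ⊆ W ∧ IsCompact (closure (φ.tropImage V)) := by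
  obtain ⟨U, hU, hxU, -⟩ := exists_isAffineOpen_mem_and_subset (U := ⊤) (x := x.point) trivial
  obtain ⟨O, hO, hWO⟩ := isOpen_iff_isOpenIn.1 hW U hU
  obtain ⟨G, ε, hG, hε, hGO⟩ := exists_finite_ball_subset hO ((hWO ⟨x, hxU⟩).1 hx)
  -- One third of `ε` each for replacing `g` by a unit at `p`, for moving from `p` to `x`, and for
  -- returning to `g` at `x`.
  obtain ⟨D, hD, T, hDaff, hxD, hT, hgen, happrox⟩ :=
    exists_units_approximating hU ⟨x, hxU⟩ hG (ε := ε / 3) (by positivity)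
  obtain ⟨φ⟩ := nonempty_canonicalMomentMap f D
  have hvery : IsVeryAffine f D := isVeryAffine_iff.2
    ⟨hDaff, _, (Subgroup.fg_iff _).2 ⟨T, rfl, hT⟩, hgen⟩
  let r : Γ(X, D)ˣ → ℝ := fun u => Analytification.seminorm (⟨x, hxD⟩ : anOpen f D) (u : Γ(X, D))
  have hr : ∀ u, 0 < r u := fun u =>
    lt_of_le_of_ne (seminorm_nonneg _ _) (seminorm_unit_ne_zero _ u).symm
  -- The first bound keeps the box inside `W`; the second keeps the units away from `0`, as
  -- compactness requires.
  let δ : Γ(X, D)ˣ → ℝ := fun u => min (ε / 3) (r u / 2)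
  refine ⟨D, φ, unitBox f D T r δ, isTropicalChart_unitBox hvery φ hT r δ, ?_, ?_,
    isCompact_closure_tropImage_unitBox hDaff φ hgen fun u _ => ?_⟩
  · refine mem_unitBox.2 ⟨hxD, fun u _ => ?_⟩
    rw [show r u = Analytification.seminorm (⟨x, hxD⟩ : anOpen f D) (u : Γ(X, D)) from rfl,
      sub_self, abs_zero]
    exact lt_min (by positivity) (half_pos (hr u))
  · intro p hp
    obtain ⟨hpD, hp⟩ := mem_unitBox.1 hp
    refine (hWO ⟨p, hD hpD⟩).2 (hGO _ fun g hg => ?_)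
    obtain ⟨u, hu, hug⟩ := happrox g hg
    have h1 := hug ⟨p, hpD⟩
    have h2 := hug ⟨x, hxD⟩
    have h3 := (hp u hu).trans_le (min_le_left _ _)
    rw [seminorm_res] at h1 h2
    change |Analytification.seminorm (⟨p, hD hpD⟩ : anOpen f U) g -
      Analytification.seminorm (⟨x, hxU⟩ : anOpen f U) g| < ε
    rw [abs_le] at h1 h2
    rw [abs_lt] at h3 ⊢
    constructor <;> linarith [h1.1, h1.2, h2.1, h2.2, h3.1, h3.2]
  · exact (min_le_right _ _).trans_lt (half_lt_self (hr u))

end Basis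

end TropicalCharts

end

theorem mainTheorem7 {K : Type u} [NontriviallyNormedField K] [IsUltrametricDist K]
    [CompleteSpace K] [IsAlgClosed K] {X : Scheme.{u}} (f : X ⟶ Spec (CommRingCat.of K))
    [IsIntegral X] [IsSeparated f] [LocallyOfFiniteType f] [QuasiCompact f] :
    -- (a)
    (TopologicalSpace.IsTopologicalBasis
        {V : Set (TropicalCharts.Analytification f) |
          ∃ (U : X.Opens) (φ : TropicalCharts.CanonicalMomentMap f U),
            TropicalCharts.IsTropicalChart V φ} ∧
      ∀ W : Set (TropicalCharts.Analytification f), IsOpen W → ∀ x ∈ W,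
        ∃ (U : X.Opens) (φ : TropicalCharts.CanonicalMomentMap f U)
          (V : Set (TropicalCharts.Analytification f)),
          TropicalCharts.IsTropicalChart V φ ∧ x ∈ V ∧ V ⊆ W ∧
            IsOpen (φ.tropImage V) ∧ IsCompact (closure (φ.tropImage V))) ∧
    -- (b)
    (∀ (U U' : X.Opens) (φ : TropicalCharts.CanonicalMomentMap f U)
        (φ' : TropicalCharts.CanonicalMomentMap f U')
        (V V' : Set (TropicalCharts.Analytification f)),
      TropicalCharts.IsTropicalChart V φ → TropicalCharts.IsTropicalChart V' φ' →
        TropicalCharts.IsVeryAffine f (U ⊓ U') ∧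
        Nonempty (TropicalCharts.CanonicalMomentMap f (U ⊓ U')) ∧
        ∀ ψ : TropicalCharts.CanonicalMomentMap f (U ⊓ U'),
          TropicalCharts.IsTropicalSubchart (V ∩ V') ψ V φ ∧
          TropicalCharts.IsTropicalSubchart (V ∩ V') ψ V' φ') ∧
    -- (c)
    (∀ (U U'' : X.Opens) (φ : TropicalCharts.CanonicalMomentMap f U)
        (V : Set (TropicalCharts.Analytification f)),
      TropicalCharts.IsTropicalChart V φ → U'' ≤ U → TropicalCharts.IsVeryAffine f U'' →
        V ⊆ TropicalCharts.anOpen f U'' →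
        Nonempty (TropicalCharts.CanonicalMomentMap f U'') ∧
        ∀ ψ : TropicalCharts.CanonicalMomentMap f U'',
          TropicalCharts.IsTropicalSubchart V ψ V φ) := by
  refine ⟨⟨TopologicalSpace.isTopologicalBasis_of_isOpen_of_nhds ?_ ?_, ?_⟩, ?_, ?_⟩
  · rintro V ⟨U, φ, h⟩
    exact h.isOpen
  · intro x W hx hW
    obtain ⟨U, φ, V, hV, hxV, hVW, -⟩ := TropicalCharts.exists_isTropicalChart_subset hW hx
    exact ⟨V, ⟨U, φ, hV⟩, hxV, hVW⟩
  · intro W hW x hx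
    obtain ⟨U, φ, V, hV, hxV, hVW, hc⟩ := TropicalCharts.exists_isTropicalChart_subset hW hx
    exact ⟨U, φ, V, hV, hxV, hVW, TropicalCharts.isOpen_tropImage hV, hc⟩
  · intro U U' φ φ' V V' hV hV'
    have h := TropicalCharts.isVeryAffine_inf hV.isVeryAffine hV'.isVeryAffine
    refine ⟨h, TropicalCharts.nonempty_canonicalMomentMap f _, fun ψ => ?_⟩
    have hψ := hV.inter hV' h ψ
    exact ⟨⟨hψ, hV, Set.inter_subset_left, inf_le_left⟩,
      ⟨hψ, hV', Set.inter_subset_right, inf_le_right⟩⟩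
  · intro U U'' φ V hV hle h hVU
    exact ⟨TropicalCharts.nonempty_canonicalMomentMap f _, fun ψ =>
      ⟨hV.of_le hle h hVU ψ, hV, subset_rfl, hle⟩⟩
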